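/- **Theorem.** Let $0<\varepsilon<1/3$ and $0<\delta\le 1$ be constants. There are a constant $c>0$ and an integer $k_0$, depending only on $\varepsilon$ and $\delta$, such that the following holds for all integers $n\ge k\ge k_0$, every set $V$ of $n$ vertices and every set $T\subseteq V$ of $k$ terminals. Consider any randomized algorithm that knows $V$ and $T$, accesses an unknown metric $w$ on $V$ only through adaptive queries (a query names two vertices $x,y\in V$ and returns $w(x,y)$), and finally outputs a subgraph of the complete graph on $V$. Suppose that for every metric $w$ on $V$ the output is, with probability at least $\delta$ over the random choices of the algorithm, a $(2-\varepsilon)$-approximate Steiner tree of $(V,T,w)$, that is, a tree that contains all vertices of $T$ and whose cost (the sum of the weights of its edges) is at most $(2-\varepsilon)$ times the minimum cost of a tree containing all vertices of $T$. Then there is a metric $w$ on $V$, all of whose distances between distinct vertices are $1$ or $2$, on which the expected number of queries made by the algorithm is at least $c\,nk$. In particular, every randomized algorithm that outputs a $(2-\varepsilon)$-approximate Steiner tree makes $\Omega(nk)$ queries in the worst case. -/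

import Mathlib

open MeasureTheory

universe u v

namespace SteinerQuery

/-- `w` is a metric on `V`: the edge weights of a complete graph satisfying the triangle
inequality. -/
structure IsMetric {V : Type u} (w : V → V → ℝ) : Prop where
  self_eq_zero : ∀ x, w x x = 0
  pos : ∀ x y, x ≠ y → 0 < w x y
  symm : ∀ x y, w x y = w y x
  triangle : ∀ x y z, w x z ≤ w x y + w y z

/-- The weight of an unordered pair. For a symmetric `w` the weight of `s(x, y)` is `w x y`; the
average only makes the expression well defined for every `w`. -/
noncomputable def edgeWeight {V : Type u} (w : V → V → ℝ) : Sym2 V → ℝ :=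
  Sym2.lift ⟨fun x y => (w x y + w y x) / 2, fun x y => by simp only [add_comm]⟩

/-- A subgraph of the complete graph on `V`. -/
abbrev CompleteSubgraph (V : Type u) : Type u := (⊤ : SimpleGraph V).Subgraph

open Classical in
/-- The total weight `w(H)` of the edges of `H`. -/
noncomputable def cost {V : Type u} [Fintype V] (w : V → V → ℝ) (H : CompleteSubgraph V) : ℝ :=
  ∑ e : Sym2 V with e ∈ H.edgeSet, edgeWeight w e

/-- `H` is a tree that contains all the terminals (and possibly further vertices). -/
def IsSteinerTree {V : Type u} (T : Finset V) (H : CompleteSubgraph V) : Prop :=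
  (T : Set V) ⊆ H.verts ∧ H.coe.IsTree

/-- The minimum cost of a Steiner tree of the instance `(V, T, w)`. -/
noncomputable def steinerCost {V : Type u} [Fintype V] (T : Finset V) (w : V → V → ℝ) : ℝ :=
  sInf {x | ∃ H : CompleteSubgraph V, IsSteinerTree T H ∧ cost w H = x}

/-- `H` is an `α`-approximate Steiner tree of the instance `(V, T, w)`. -/
def IsApproxSteinerTree {V : Type u} [Fintype V] (T : Finset V) (w : V → V → ℝ) (α : ℝ)
    (H : CompleteSubgraph V) : Prop :=
  IsSteinerTree T H ∧ cost w H ≤ α * steinerCost T w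

/-- A deterministic adaptive query algorithm, as a decision tree: it either stops with an output,
or queries the weight of a pair of vertices and continues depending on the real number it gets. -/
inductive QueryTree (V : Type u) (O : Type v) : Type (max u v)
  | done (o : O) : QueryTree V O
  | query (x y : V) (next : ℝ → QueryTree V O) : QueryTree V O

namespace QueryTree

/-- The output of the algorithm on input `w`. -/
def output {V : Type u} {O : Type v} (w : V → V → ℝ) : QueryTree V O → O
  | done o => o
  | query x y next => (next (w x y)).output w

/-- The number of queries that the algorithm makes on input `w`. -/
def numQueries {V : Type u} {O : Type v} (w : V → V → ℝ) : QueryTree V O → ℕ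
  | done _ => 0
  | query x y next => (next (w x y)).numQueries w + 1

end QueryTree

/-- A randomized query algorithm: a deterministic one for each outcome `r` of its random coins.
On every input the output and the number of queries are random variables. -/
structure RandomizedAlgorithm (V : Type u) (O : Type u) (R : Type v) [MeasurableSpace R] where
  coins : Measure R
  isProbabilityMeasure : IsProbabilityMeasure coins
  run : R → QueryTree V O
  measurable_output : ∀ (w : V → V → ℝ) (S : Set O), MeasurableSet {r | (run r).output w ∈ S}
  measurable_numQueries : ∀ w : V → V → ℝ, Measurable fun r => (run r).numQueries w

namespace RandomizedAlgorithm

/-- On every metric `w` on `V`, the algorithm outputs an `α`-approximate Steiner tree of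
`(V, T, w)` with probability at least `δ`. -/
def ComputesApproxSteinerTree {V : Type u} [Fintype V] {R : Type v} [MeasurableSpace R]
    (A : RandomizedAlgorithm V (CompleteSubgraph V) R) (T : Finset V) (α δ : ℝ) : Prop :=
  ∀ w : V → V → ℝ, IsMetric w →
    ENNReal.ofReal δ ≤ A.coins {r | IsApproxSteinerTree T w α ((A.run r).output w)}

/-- The expected number of queries on input `w`. -/
noncomputable def expectedQueries {V O : Type u} {R : Type v} [MeasurableSpace R]
    (A : RandomizedAlgorithm V O R) (w : V → V → ℝ) : ENNReal :=
  ∫⁻ r, ((A.run r).numQueries w : ENNReal) ∂A.coins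

end RandomizedAlgorithm

end SteinerQuery

/-! Almost all terminals are split into groups of a large constant size `d`, and each group has a
hidden centre among the `N` ungrouped vertices. A vertex is at distance 1 from the centre of its
group, and all other distances are 2. Joining groups to their centres costs `(1 + O(1/d)) k`, while
a tree with few unit edges costs about `2k`. So a `(2 - ε)`-approximate tree has at least `εk/2`
unit edges. A group accounts for at most `d` of them, so the tree exposes the centres of at least
`εk/(2d)` groups (`IsSteinerTree.le_card_found`).

Finding one centre costs about `N/2` queries on average (`card_hits_mul_le`), and a query serves at
most one group, so the costs add up (`card_mul_sum_found_le`). Centres guessed in the output without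
a query are covered by querying the `O(k)` output edges afterwards (`thenProbe`). Averaging over
uniformly random centres, as in Yao's principle, passes to randomized algorithms
(`exists_le_expectedQueries`). A fraction of about `1/d` of the terminals stays ungrouped, so that
`N ≥ n/d` even when `k = n`. -/

namespace SteinerQuery

/-! ### Decision trees and the search for one hidden element. -/

namespace QueryTree

/-- The pairs that the algorithm queries on input `w`, in order. -/
def queries {V : Type u} {O : Type v} (w : V → V → ℝ) : QueryTree V O → List (V × V)
  | done _ => []
  | query x y next => (x, y) :: (next (w x y)).queries w

theorem length_queries {V : Type u} {O : Type v} (w : V → V → ℝ) (τ : QueryTree V O) :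
    (τ.queries w).length = τ.numQueries w := by
  induction τ with
  | done o => rfl
  | query x y next ih => simp [queries, numQueries, ih]

/-- The algorithm that queries the pairs of a list, whatever the answers. -/
def probe {V : Type u} : List (V × V) → QueryTree V PUnit.{v + 1}
  | [] => done PUnit.unit
  | p :: l => query p.1 p.2 fun _ => probe l

theorem queries_probe {V : Type u} (w : V → V → ℝ) (l : List (V × V)) :
    (probe.{u, v} l).queries w = l := by
  induction l with
  | nil => rfl
  | cons p l ih => simp [probe, queries, ih]

/-- The algorithm that, after having computed an output `o`, also queries the pairs of `L o`. -/
def thenProbe {V : Type u} {O : Type v} (L : O → List (V × V)) :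
    QueryTree V O → QueryTree V PUnit.{v + 1}
  | done o => probe (L o)
  | query x y next => query x y fun a => (next a).thenProbe L

theorem queries_thenProbe {V : Type u} {O : Type v} (L : O → List (V × V)) (w : V → V → ℝ)
    (τ : QueryTree V O) : (τ.thenProbe L).queries w = τ.queries w ++ L (τ.output w) := by
  induction τ with
  | done o => simp [thenProbe, queries, queries_probe, output]
  | query x y next ih => simp [thenProbe, queries, ih, output]

open Classical in
/-- Searching for a hidden `s ∈ A`: if the inputs `w s` and `w s'` differ only at pairs with label
`s` or `s'`, then the algorithm makes, on average over `A`, at least `(|A| + 1) / 2` labelled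
queries for each `s` that it finds. -/
theorem card_hits_mul_le {V : Type u} {O : Type v} {S : Type*} (w : S → V → V → ℝ)
    (lab : V × V → Option S)
    (hw : ∀ s s' x y, lab (x, y) ≠ some s → lab (x, y) ≠ some s' → w s x y = w s' x y)
    (τ : QueryTree V O) (A : Finset S) :
    (A.card + 1) * (A.filter fun s => ∃ p ∈ τ.queries (w s), lab p = some s).card ≤
      2 * ∑ s ∈ A, (τ.queries (w s)).countP fun p => (lab p).isSome := by
  induction τ generalizing A with
  | done o => simp [queries]
  | query x y next ih =>
    rcases A.eq_empty_or_nonempty with rfl | ⟨s₁, hs₁⟩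
    · simp
    by_cases hA : ∃ s₀ ∈ A, lab (x, y) = some s₀
    · obtain ⟨s₀, hs₀, hl⟩ := hA
      -- All inputs except `s₀` give the same answer and stay in one subtree; if there are none, the
      -- value 0 is arbitrary.
      obtain ⟨a, ha⟩ : ∃ a, ∀ s ∈ A.erase s₀, w s x y = a := by
        rcases (A.erase s₀).eq_empty_or_nonempty with h | ⟨s₂, hs₂⟩
        · exact ⟨0, by simp [h]⟩
        · refine ⟨w s₂ x y, fun s hs => hw _ _ _ _ ?_ ?_⟩ <;> rw [hl] <;> intro h <;>
            simp_all
      have key := ih a (A.erase s₀)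
      have e1 : (A.filter fun s => ∃ p ∈ (query x y next).queries (w s), lab p = some s).card
          ≤ ((A.erase s₀).filter fun s => ∃ p ∈ (next a).queries (w s), lab p = some s).card + 1 := by
        refine le_trans (Finset.card_le_card (t := insert s₀ _) ?_) (Finset.card_insert_le _ _)
        intro s hs
        rw [Finset.mem_insert]
        by_cases h : s = s₀
        · exact Or.inl h
        right
        rw [Finset.mem_filter] at hs ⊢
        have hs' : s ∈ A.erase s₀ := Finset.mem_erase.2 ⟨h, hs.1⟩
        refine ⟨hs', ?_⟩
        obtain ⟨p, hp, hps⟩ := hs.2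
        rw [queries, ha s hs', List.mem_cons] at hp
        rcases hp with rfl | hp
        · rw [hl] at hps; simp_all
        · exact ⟨p, hp, hps⟩
      have e2 : (∑ s ∈ A.erase s₀, (((next a).queries (w s)).countP fun p => (lab p).isSome)) + A.card
          ≤ ∑ s ∈ A, ((query x y next).queries (w s)).countP fun p => (lab p).isSome := by
        rw [← Finset.add_sum_erase _ _ hs₀]
        have : ∑ s ∈ A.erase s₀, ((query x y next).queries (w s)).countP (fun p => (lab p).isSome)
          = ∑ s ∈ A.erase s₀, ((((next a).queries (w s)).countP fun p => (lab p).isSome) + 1) := by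
          refine Finset.sum_congr rfl fun s hs => ?_
          rw [queries, ha s hs, List.countP_cons, hl]
          simp
        rw [this, Finset.sum_add_distrib, queries, List.countP_cons, hl]
        have := Finset.card_erase_add_one hs₀
        simp only [Finset.sum_const, smul_eq_mul, Option.isSome_some, if_true]
        omega
      have e3 := Finset.card_filter_le (A.erase s₀)
        fun s => ∃ p ∈ (next a).queries (w s), lab p = some s
      have e4 := Finset.card_erase_add_one hs₀
      set h' := ((A.erase s₀).filter fun s => ∃ p ∈ (next a).queries (w s), lab p = some s).card
      -- The query finds at most `s₀`, but every element of `A` pays for it. The surplus `h' + |A| +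
      -- 1` is at most `2 |A|` because `h' ≤ |A| - 1`.
      calc _ ≤ (A.card + 1) * (h' + 1) := Nat.mul_le_mul_left _ e1
        _ = ((A.erase s₀).card + 1) * h' + (h' + A.card + 1) := by rw [← e4]; ring
        _ ≤ 2 * (_ + A.card) := by rw [mul_add]; omega
        _ ≤ _ := Nat.mul_le_mul_left _ e2
    -- No element of `A` is tested, so all of `A` follows the same branch and no hit is gained.
    · push Not at hA
      have ha : ∀ s ∈ A, w s x y = w s₁ x y := fun s hs => hw _ _ _ _ (hA s hs) (hA s₁ hs₁)
      have key := ih (w s₁ x y) A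
      have e1 : (A.filter fun s => ∃ p ∈ (query x y next).queries (w s), lab p = some s)
          = A.filter fun s => ∃ p ∈ (next (w s₁ x y)).queries (w s), lab p = some s := by
        refine Finset.filter_congr fun s hs => ?_
        rw [queries, ha s hs]
        simp [hA s hs]
      rw [e1]
      refine key.trans (Nat.mul_le_mul_left _ (Finset.sum_le_sum fun s hs => ?_))
      rw [queries, ha s hs, List.countP_cons]
      omega

end QueryTree

/-- Exchanging the new value `s` with the old value `f g` is an involution on pairs `(f, s)`. This
allows averaging over the centre of one group with the others fixed. -/
theorem sum_sum_update {ι S M : Type*} [Fintype ι] [DecidableEq ι] [Fintype S] [AddCommMonoid M]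
    (g : ι) (F : (ι → S) → M) :
    ∑ f : ι → S, ∑ s : S, F (Function.update f g s) = Fintype.card S • ∑ f, F f := by
  have hinv : Function.Involutive
      fun p : (ι → S) × S => (Function.update p.1 g p.2, p.1 g) := by
    rintro ⟨f, s⟩
    simp
  calc _ = ∑ p : (ι → S) × S, F (Function.update p.1 g p.2) := by rw [Fintype.sum_prod_type]
    _ = ∑ p : (ι → S) × S, F p.1 := Equiv.sum_comp hinv.toPerm fun p => F p.1
    _ = _ := by simp [Fintype.sum_prod_type, Finset.smul_sum]

/-! ### Edge counts and upper bounds for the Steiner cost. -/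

open Classical in
/-- The edges of a subgraph of the complete graph. -/
noncomputable def edges {V : Type u} [Fintype V] (H : CompleteSubgraph V) : Finset (Sym2 V) :=
  {e : Sym2 V | e ∈ H.edgeSet}

theorem mem_edges {V : Type u} [Fintype V] {H : CompleteSubgraph V} {e : Sym2 V} :
    e ∈ edges H ↔ e ∈ H.edgeSet := by
  simp [edges]

theorem cost_eq_sum_edges {V : Type u} [Fintype V] (w : V → V → ℝ) (H : CompleteSubgraph V) :
    cost w H = ∑ e ∈ edges H, edgeWeight w e := rfl

theorem IsMetric.edgeWeight_mk {V : Type u} {w : V → V → ℝ} (hw : IsMetric w) (x y : V) :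
    edgeWeight w s(x, y) = w x y := by
  simp [edgeWeight, hw.symm y x]

theorem IsMetric.nonneg {V : Type u} {w : V → V → ℝ} (hw : IsMetric w) (x y : V) :
    0 ≤ w x y := by
  by_cases h : x = y
  · rw [h, hw.self_eq_zero]
  · exact (hw.pos x y h).le

theorem IsMetric.edgeWeight_nonneg {V : Type u} {w : V → V → ℝ} (hw : IsMetric w) (e : Sym2 V) :
    0 ≤ edgeWeight w e := by
  induction e with
  | _ x y => rw [hw.edgeWeight_mk]; exact hw.nonneg x y

theorem IsSteinerTree.card_le {V : Type u} [Fintype V] {T : Finset V} {H : CompleteSubgraph V}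
    (h : IsSteinerTree T H) : T.card ≤ (edges H).card + 1 := by
  classical
  have h1 := (SimpleGraph.isTree_iff_connected_and_card.1 h.2).2
  have h2 : Nat.card H.coe.edgeSet = (edges H).card := by
    have : ((edges H : Finset (Sym2 V)) : Set (Sym2 V)) = H.edgeSet := by
      ext e; simp [mem_edges]
    rw [← Set.ncard_coe_finset, this, ← SimpleGraph.Subgraph.image_coe_edgeSet_coe,
      Set.ncard_image_of_injective _ (Sym2.map.injective Subtype.val_injective)]
    rfl
  rw [← h2, h1, ← Set.ncard_coe_finset, Nat.card_coe_set_eq]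
  exact Set.ncard_le_ncard h.1 (Set.toFinite _)

/-- Passing to a spanning tree only removes edges of nonnegative weight, so upper bounds on the
optimum need no check of acyclicity. -/
theorem steinerCost_le_of_connected {V : Type u} [Fintype V] {T : Finset V} {w : V → V → ℝ}
    (hw : IsMetric w) (H : CompleteSubgraph V) (hT : (T : Set V) ⊆ H.verts)
    (hH : H.coe.Connected) : steinerCost T w ≤ cost w H := by
  obtain ⟨F, hle, hF⟩ := hH.exists_isTree_le
  let H' : CompleteSubgraph V :=
    { verts := H.verts
      Adj := fun x y => ∃ (hx : x ∈ H.verts) (hy : y ∈ H.verts), F.Adj ⟨x, hx⟩ ⟨y, hy⟩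
      adj_sub := by
        rintro x y ⟨hx, hy, h⟩
        exact H.adj_sub (hle h)
      edge_vert := fun ⟨hx, _⟩ => hx
      symm := ⟨fun x y ⟨hx, hy, h⟩ => ⟨hy, hx, h.symm⟩⟩ }
  have hcoe : H'.coe = F := by
    ext ⟨x, hx⟩ ⟨y, hy⟩
    exact ⟨fun ⟨_, _, h⟩ => h, fun h => ⟨hx, hy, h⟩⟩
  have hsub : edges H' ⊆ edges H := by
    intro e he
    rw [mem_edges] at he ⊢
    induction e with
    | _ x y =>
      obtain ⟨hx, hy, h⟩ := he
      exact hle h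
  refine le_trans (csInf_le ⟨0, ?_⟩ ⟨H', ⟨hT, ?_⟩, rfl⟩) ?_
  · rintro _ ⟨K, -, rfl⟩
    exact Finset.sum_nonneg fun e _ => hw.edgeWeight_nonneg e
  · rw [hcoe]; exact hF
  · exact Finset.sum_le_sum_of_subset_of_nonneg hsub fun e _ _ => hw.edgeWeight_nonneg e

/-- A set of vertices in which every vertex reaches `r` by two steps of `par` bounds the cost of a
Steiner tree. -/
theorem steinerCost_le_of_parent {V : Type u} [Fintype V] {T : Finset V} {w : V → V → ℝ}
    (hw : IsMetric w) (W : Finset V) (hT : T ⊆ W) (r : V) (hr : r ∈ W) (par : V → V)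
    (hpar : ∀ x ∈ W, par x ∈ W) (hroot : ∀ x ∈ W, par (par x) = r) :
    steinerCost T w ≤ ∑ x ∈ W, w x (par x) := by
  classical
  let H : CompleteSubgraph V :=
    { verts := W
      Adj := fun x y => x ≠ y ∧ ((x ∈ W ∧ y = par x) ∨ (y ∈ W ∧ x = par y))
      adj_sub := fun h => h.1
      edge_vert := by
        rintro x y ⟨-, ⟨hx, -⟩ | ⟨hy, rfl⟩⟩
        · exact hx
        · exact hpar y hy
      symm := ⟨fun x y ⟨h, h'⟩ => ⟨h.symm, h'.symm⟩⟩ }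
  have step : ∀ x (hx : x ∈ W), H.coe.Reachable ⟨x, hx⟩ ⟨par x, hpar x hx⟩ := by
    intro x hx
    by_cases h : x = par x
    · have : (⟨x, hx⟩ : H.verts) = ⟨par x, hpar x hx⟩ := Subtype.ext h
      rw [this]
    · exact SimpleGraph.Adj.reachable (G := H.coe) ⟨h, Or.inl ⟨hx, rfl⟩⟩
  have hconn : H.coe.Connected := by
    rw [SimpleGraph.connected_iff_exists_forall_reachable]
    refine ⟨⟨r, hr⟩, ?_⟩
    rintro ⟨x, hx⟩
    have h2 := (step x hx).trans (step (par x) (hpar x hx))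
    have : (⟨par (par x), hpar _ (hpar x hx)⟩ : H.verts) = ⟨r, hr⟩ := Subtype.ext (hroot x hx)
    rw [this] at h2
    exact h2.symm
  refine (steinerCost_le_of_connected hw H (by exact_mod_cast hT) hconn).trans ?_
  have hsub : edges H ⊆ W.image fun x => s(x, par x) := by
    intro e he
    rw [mem_edges] at he
    rw [Finset.mem_image]
    induction e with
    | _ x y =>
      obtain ⟨-, ⟨hx, h⟩ | ⟨hy, h⟩⟩ := he
      · exact ⟨x, hx, congrArg (fun z => s(x, z)) h.symm⟩
      · exact ⟨y, hy, Sym2.eq_swap.trans (congrArg (fun z => s(z, y)) h.symm)⟩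
  rw [cost_eq_sum_edges]
  refine (Finset.sum_le_sum_of_subset_of_nonneg hsub
    fun e _ _ => hw.edgeWeight_nonneg e).trans ?_
  refine (Finset.sum_image_le_of_nonneg fun e _ => hw.edgeWeight_nonneg e).trans
    (le_of_eq (Finset.sum_congr rfl fun x _ => hw.edgeWeight_mk _ _))

/-! ### The hard instances. -/

/-- The pairs of distance `1` in the hard instances: the vertices `x` of the group `γ x` are
joined to the hidden centre of that group. -/
def Linked {V : Type u} {ι : Type*} (γ : V → Option ι) (f : ι → {v // γ v = none})
    (x y : V) : Prop :=
  ∃ g, (γ x = some g ∧ y = f g) ∨ (γ y = some g ∧ x = f g)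

theorem Linked.symm {V : Type u} {ι : Type*} {γ : V → Option ι} {f : ι → {v // γ v = none}}
    {x y : V} (h : Linked γ f x y) : Linked γ f y x :=
  h.imp fun _ => Or.symm

open Classical in
/-- The hard instances: the distance of `x ≠ y` is `1` if one of them is the hidden centre of the
group of the other, and `2` otherwise. -/
noncomputable def hiddenWeight {V : Type u} {ι : Type*} (γ : V → Option ι)
    (f : ι → {v // γ v = none}) (x y : V) : ℝ :=
  if x = y then 0 else if Linked γ f x y then 1 else 2

theorem hiddenWeight_eq_one_or_two {V : Type u} {ι : Type*} (γ : V → Option ι)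
    (f : ι → {v // γ v = none}) {x y : V} (h : x ≠ y) :
    hiddenWeight γ f x y = 1 ∨ hiddenWeight γ f x y = 2 := by
  unfold hiddenWeight
  rw [if_neg h]
  split_ifs <;> simp

theorem isMetric_hiddenWeight {V : Type u} {ι : Type*} (γ : V → Option ι)
    (f : ι → {v // γ v = none}) : IsMetric (hiddenWeight γ f) where
  self_eq_zero x := by simp [hiddenWeight]
  pos x y h := by rcases hiddenWeight_eq_one_or_two γ f h with h | h <;> rw [h] <;> norm_num
  symm x y := by
    have : Linked γ f x y ↔ Linked γ f y x := ⟨Linked.symm, Linked.symm⟩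
    classical
    exact if_congr eq_comm rfl (if_congr this rfl rfl)
  triangle x y z := by
    by_cases hxy : x = y
    · subst hxy; simp [hiddenWeight]
    by_cases hyz : y = z
    · subst hyz; simp [hiddenWeight]
    have h1 := hiddenWeight_eq_one_or_two γ f hxy
    have h2 := hiddenWeight_eq_one_or_two γ f hyz
    by_cases hxz : x = z
    · subst hxz
      have : hiddenWeight γ f x x = 0 := by simp [hiddenWeight]
      rcases h1 with h1 | h1 <;> rcases h2 with h2 | h2 <;> rw [h1, h2, this] <;> norm_num
    have h3 := hiddenWeight_eq_one_or_two γ f hxz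
    rcases h1 with h1 | h1 <;> rcases h2 with h2 | h2 <;> rcases h3 with h3 | h3 <;>
      rw [h1, h2, h3] <;> norm_num

theorem hiddenWeight_le_two {V : Type u} {ι : Type*} (γ : V → Option ι)
    (f : ι → {v // γ v = none}) (x y : V) : hiddenWeight γ f x y ≤ 2 := by
  unfold hiddenWeight
  split_ifs <;> norm_num

open Classical in
/-- Joining every group to its centre, and all the centres and ungrouped terminals to one of
them, gives a cheap Steiner tree. -/
theorem steinerCost_hiddenWeight_le {V : Type u} [Fintype V] {ι : Type*} [Fintype ι] [Nonempty ι]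
    (γ : V → Option ι) (T : Finset V)
    (f : ι → {v // γ v = none}) :
    steinerCost T (hiddenWeight γ f) ≤
      T.card + 2 * (Fintype.card ι + (T.filter fun v => γ v = none).card) := by
  obtain ⟨g₀⟩ := ‹Nonempty ι›
  let C : Finset V := Finset.univ.image (fun g => (f g : V)) ∪ T.filter fun v => γ v = none
  let D : Finset V := T.filter fun v => γ v ≠ none
  -- Centres are ungrouped, so two steps always end at `f g₀`, which is its own parent.
  let par : V → V := fun v => match γ v with
    | some g => f g
    | none => f g₀
  have par_some : ∀ v g, γ v = some g → par v = f g := fun v g h => by simp [par, h]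
  have par_none : ∀ v, γ v = none → par v = f g₀ := fun v h => by simp [par, h]
  have hfC : ∀ g, (f g : V) ∈ C := fun g => Finset.mem_union_left _ (by simp)
  have hC : ∀ v ∈ C, γ v = none := by
    intro v hv
    rcases Finset.mem_union.1 hv with hv | hv
    · obtain ⟨g, -, rfl⟩ := Finset.mem_image.1 hv
      exact (f g).2
    · exact (Finset.mem_filter.1 hv).2
  have hmem : ∀ v, ∃ g, par v = f g := by
    intro v
    cases h : γ v with
    | none => exact ⟨g₀, par_none v h⟩
    | some g => exact ⟨g, par_some v g h⟩
  have main := steinerCost_le_of_parent (isMetric_hiddenWeight γ f) (D ∪ C) (T := T)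
    (by
      intro v hv
      by_cases h : γ v = none
      · simp [C, hv, h]
      · simp [D, hv, h])
    (f g₀) (Finset.mem_union_right _ (hfC g₀)) par
    (fun v _ => by obtain ⟨g, h⟩ := hmem v; rw [h]; exact Finset.mem_union_right _ (hfC g))
    (fun v _ => by obtain ⟨g, h⟩ := hmem v; rw [h]; exact par_none _ (f g).2)
  have hdisj : Disjoint D C := by
    rw [Finset.disjoint_left]
    intro v hD hCv
    exact (Finset.mem_filter.1 hD).2 (hC v hCv)
  refine main.trans ?_
  rw [Finset.sum_union hdisj]
  refine add_le_add ?_ ?_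
  · have : ∀ v ∈ D, hiddenWeight γ f v (par v) ≤ 1 := by
      intro v hv
      obtain ⟨g, hg⟩ := Option.ne_none_iff_exists'.1 (Finset.mem_filter.1 hv).2
      have hl : Linked γ f v (par v) := ⟨g, Or.inl ⟨hg, par_some v g hg⟩⟩
      unfold hiddenWeight
      rw [if_pos hl]
      split_ifs <;> norm_num
    refine (Finset.sum_le_card_nsmul _ _ 1 this).trans ?_
    simpa using Finset.card_filter_le _ _
  · refine (Finset.sum_le_card_nsmul _ _ 2 fun v _ => hiddenWeight_le_two γ f _ _).trans ?_
    have h1 : C.card ≤ Fintype.card ι + (T.filter fun v => γ v = none).card :=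
      (Finset.card_union_le _ _).trans (Nat.add_le_add_right Finset.card_image_le _)
    have h2 : (C.card : ℝ) ≤ Fintype.card ι + (T.filter fun v => γ v = none).card := by
      exact_mod_cast h1
    rw [nsmul_eq_mul]
    linarith

/-! ### The query cost of finding centres. -/

/-- The vertices that the pair `p` tests for being the centre of the group `g`. -/
def tested {V : Type u} {ι : Type*} [DecidableEq ι] (γ : V → Option ι) (g : ι) (p : V × V) :
    Option {v // γ v = none} :=
  if h : γ p.1 = some g ∧ γ p.2 = none then some ⟨p.2, h.2⟩
  else if h : γ p.2 = some g ∧ γ p.1 = none then some ⟨p.1, h.2⟩ else none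

/-- The two orientations exclude each other, since a candidate centre is ungrouped. With `s = f g`
the right side is the clause for `g` in `Linked`. -/
theorem tested_eq_some_iff {V : Type u} {ι : Type*} [DecidableEq ι] {γ : V → Option ι} {g : ι}
    {x y : V} {s : {v // γ v = none}} :
    tested γ g (x, y) = some s ↔ (γ x = some g ∧ y = s) ∨ (γ y = some g ∧ x = s) := by
  obtain ⟨s, hs⟩ := s
  unfold tested
  split_ifs with h1 h2
  · simp only [Option.some.injEq, Subtype.mk.injEq]
    constructor
    · exact fun h => Or.inl ⟨h1.1, h⟩
    · rintro (h | h)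
      · exact h.2
      · rw [h1.2] at h; simp at h
  · simp only [Option.some.injEq, Subtype.mk.injEq]
    constructor
    · exact fun h => Or.inr ⟨h2.1, h⟩
    · rintro (h | h)
      · rw [h2.2] at h; simp at h
      · exact h.2
  · simp only [false_iff]
    rintro (⟨h, rfl⟩ | ⟨h, rfl⟩)
    · exact h1 ⟨h, hs⟩
    · exact h2 ⟨h, hs⟩

/-- Moving the centre of `g` from `s` to `s'` affects only pairs between the group and one of these
two vertices. This is the hypothesis `hw` of `card_hits_mul_le`. -/
theorem hiddenWeight_update_eq {V : Type u} {ι : Type*} [DecidableEq ι] (γ : V → Option ι)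
    (f : ι → {v // γ v = none}) (g : ι) (s s' : {v // γ v = none}) (x y : V)
    (h : tested γ g (x, y) ≠ some s) (h' : tested γ g (x, y) ≠ some s') :
    hiddenWeight γ (Function.update f g s) x y = hiddenWeight γ (Function.update f g s') x y := by
  have key : ∀ t t', tested γ g (x, y) ≠ some t → Linked γ (Function.update f g t) x y →
      Linked γ (Function.update f g t') x y := by
    rintro t t' ht ⟨g', hg'⟩
    by_cases hgg : g' = g
    · subst hgg
      rw [Function.update_self] at hg'
      exact absurd (tested_eq_some_iff.2 hg') ht
    · refine ⟨g', ?_⟩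
      rw [Function.update_of_ne hgg] at hg' ⊢
      exact hg'
  have : Linked γ (Function.update f g s) x y ↔ Linked γ (Function.update f g s') x y :=
    ⟨key s s' h, key s' s h'⟩
  classical
  exact if_congr Iff.rfl rfl (if_congr this rfl rfl)

/-- A query tests a vertex for at most one group. -/
theorem sum_countP_tested_le {V : Type u} {ι : Type*} [DecidableEq ι] [Fintype ι]
    (γ : V → Option ι) (l : List (V × V)) :
    ∑ g, l.countP (fun p => (tested γ g p).isSome) ≤ l.length := by
  induction l with
  | nil => simp
  | cons p l ih =>
    simp only [List.countP_cons, Finset.sum_add_distrib, List.length_cons]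
    refine Nat.add_le_add ih ?_
    rw [← Finset.card_filter, Finset.card_le_one]
    intro g hg g' hg'
    obtain ⟨x, y⟩ := p
    simp only [Finset.mem_filter, Finset.mem_univ, true_and, Option.isSome_iff_exists] at hg hg'
    obtain ⟨⟨s, hs⟩, h⟩ := hg
    obtain ⟨⟨s', hs'⟩, h'⟩ := hg'
    rw [tested_eq_some_iff] at h h'
    rcases h with ⟨a, b⟩ | ⟨a, b⟩ <;> rcases h' with ⟨a', b'⟩ | ⟨a', b'⟩ <;> simp_all

open Classical in
/-- The groups whose centre is tested by a pair of the list. -/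
noncomputable def found {V : Type u} {ι : Type*} [Fintype ι] (γ : V → Option ι)
    (f : ι → {v // γ v = none}) (l : List (V × V)) : Finset ι :=
  {g | ∃ p ∈ l, tested γ g p = some (f g)}

open Classical in
/-- Finding the centre of a group takes, on average over all hidden centres, half as many queries
as there are candidates. -/
theorem card_mul_sum_found_le {V : Type u} [Fintype V] {O : Type v} {ι : Type*} [Fintype ι]
    (γ : V → Option ι) (τ : QueryTree V O) :
    Fintype.card {v // γ v = none} *
        ∑ f : ι → {v // γ v = none}, (found γ f (τ.queries (hiddenWeight γ f))).card ≤
      2 * ∑ f : ι → {v // γ v = none}, τ.numQueries (hiddenWeight γ f) := by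
  set N := Fintype.card {v // γ v = none} with hN
  rcases Nat.eq_zero_or_pos N with h0 | hpos
  · simp [h0]
  have group : ∀ g : ι, N * ∑ f : ι → {v // γ v = none},
        (if ∃ p ∈ τ.queries (hiddenWeight γ f), tested γ g p = some (f g) then 1 else 0) ≤
      2 * ∑ f : ι → {v // γ v = none},
        (τ.queries (hiddenWeight γ f)).countP (fun p => (tested γ g p).isSome) := by
    intro g
    -- The extra factor `N` turns both sides, by `sum_sum_update`, into sums over `f` and a fresh
    -- centre of `g`. For each fixed `f` what remains is the search for one hidden element.
    refine Nat.le_of_mul_le_mul_left ?_ hpos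
    have e1 := sum_sum_update g fun f : ι → {v // γ v = none} =>
      if ∃ p ∈ τ.queries (hiddenWeight γ f), tested γ g p = some (f g) then 1 else 0
    have e2 := sum_sum_update g fun f : ι → {v // γ v = none} =>
      (τ.queries (hiddenWeight γ f)).countP (fun p => (tested γ g p).isSome)
    rw [smul_eq_mul, ← hN] at e1 e2
    rw [mul_left_comm N 2, ← e1, ← e2, Finset.mul_sum, Finset.mul_sum]
    refine Finset.sum_le_sum fun f _ => ?_
    have := QueryTree.card_hits_mul_le (fun s => hiddenWeight γ (Function.update f g s))
      (tested γ g) (fun s s' x y => hiddenWeight_update_eq γ f g s s' x y) τ Finset.univ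
    rw [Finset.card_filter, Finset.card_univ, ← hN] at this
    refine le_trans ?_ this
    simp only [Function.update_self]
    refine (Nat.mul_le_mul_right _ (Nat.le_succ N)).trans (le_of_eq ?_)
    congr!
  calc _ = ∑ g : ι, N * ∑ f : ι → {v // γ v = none},
        (if ∃ p ∈ τ.queries (hiddenWeight γ f), tested γ g p = some (f g) then 1 else 0) := by
        rw [← Finset.mul_sum, Finset.sum_comm]
        simp only [found, Finset.card_filter]
    _ ≤ ∑ g : ι, 2 * ∑ f : ι → {v // γ v = none},
        (τ.queries (hiddenWeight γ f)).countP (fun p => (tested γ g p).isSome) :=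
        Finset.sum_le_sum fun g _ => group g
    _ = 2 * ∑ f : ι → {v // γ v = none}, ∑ g,
        (τ.queries (hiddenWeight γ f)).countP (fun p => (tested γ g p).isSome) := by
        rw [← Finset.mul_sum, Finset.sum_comm]
    _ ≤ _ := by
        refine Nat.mul_le_mul_left _ (Finset.sum_le_sum fun f _ => ?_)
        rw [← QueryTree.length_queries]
        exact sum_countP_tested_le γ _

/-! ### Correct outputs expose many centres. -/

open Classical in
/-- A Steiner tree that is cheap in a hard instance contains edges at the centres of many
groups. -/
theorem IsSteinerTree.le_card_found {V : Type u} [Fintype V] {ι : Type*} [Fintype ι]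
    {T : Finset V} {H : CompleteSubgraph V} (hH : IsSteinerTree T H) (γ : V → Option ι) (d : ℕ)
    (hd : ∀ g, (Finset.univ.filter fun v => γ v = some g).card ≤ d)
    (f : ι → {v // γ v = none}) :
    2 * ((T.card : ℝ) - 1) - cost (hiddenWeight γ f) H ≤
      d * (found γ f ((edges H).toList.map Quot.out)).card := by
  have hw := isMetric_hiddenWeight γ f
  set P := found γ f ((edges H).toList.map Quot.out) with hP
  let E := (edges H).filter fun e => edgeWeight (hiddenWeight γ f) e = 1
  have hcost : 2 * ((edges H).card : ℝ) - E.card ≤ cost (hiddenWeight γ f) H := by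
    rw [cost_eq_sum_edges, Finset.card_eq_sum_ones, Finset.card_filter]
    push_cast
    rw [Finset.mul_sum, ← Finset.sum_sub_distrib]
    refine Finset.sum_le_sum fun e he => ?_
    rw [mem_edges] at he
    induction e with
    | _ x y =>
      rw [hw.edgeWeight_mk]
      rcases hiddenWeight_eq_one_or_two γ f (H.adj_sub he : x ≠ y) with h | h <;> norm_num [h]
  -- A unit edge is determined by its group `g` and its endpoint in that group, which leaves at most
  -- `d` edges per group.
  have hE : E ⊆ P.biUnion fun g =>
      (Finset.univ.filter fun v => γ v = some g).image fun v => s(v, (f g : V)) := by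
    intro e he
    obtain ⟨he1, he2⟩ := Finset.mem_filter.1 he
    rw [Finset.mem_biUnion]
    obtain ⟨⟨x, y⟩, hxy⟩ : ∃ p : V × V, Quot.out e = p := ⟨_, rfl⟩
    have hexy : s(x, y) = e := by rw [← Quot.out_eq e, hxy]
    rw [← hexy, hw.edgeWeight_mk] at he2
    have hl : Linked γ f x y := by
      by_contra hl
      unfold hiddenWeight at he2
      rw [if_neg hl] at he2
      split_ifs at he2 <;> norm_num at he2
    obtain ⟨g, hg⟩ := hl
    refine ⟨g, ?_, ?_⟩
    · rw [hP, found, Finset.mem_filter]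
      refine ⟨Finset.mem_univ _, (x, y), ?_, tested_eq_some_iff.2 hg⟩
      rw [List.mem_map]
      exact ⟨e, Finset.mem_toList.2 he1, hxy⟩
    · rw [Finset.mem_image, ← hexy]
      rcases hg with ⟨h, rfl⟩ | ⟨h, rfl⟩
      · exact ⟨x, by simp [h], rfl⟩
      · exact ⟨y, by simp [h], Sym2.eq_swap⟩
  have hcard : E.card ≤ d * P.card := by
    refine (Finset.card_le_card hE).trans ?_
    rw [mul_comm]
    exact Finset.card_biUnion_le_card_mul _ _ _ fun g _ => Finset.card_image_le.trans (hd g)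
  have hcard' : (E.card : ℝ) ≤ d * P.card := by exact_mod_cast hcard
  have hT : (T.card : ℝ) ≤ (edges H).card + 1 := by exact_mod_cast hH.card_le
  linarith

/-- Distinct vertices are at distance at least 1. Hence an approximate tree has few edges and is
cheap to probe. -/
theorem card_edges_le_cost {V : Type u} [Fintype V] {ι : Type*} (γ : V → Option ι)
    (f : ι → {v // γ v = none}) (H : CompleteSubgraph V) :
    ((edges H).card : ℝ) ≤ cost (hiddenWeight γ f) H := by
  rw [cost_eq_sum_edges, Finset.card_eq_sum_ones]
  push_cast
  refine Finset.sum_le_sum fun e he => ?_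
  rw [mem_edges] at he
  induction e with
  | _ x y =>
    rw [(isMetric_hiddenWeight γ f).edgeWeight_mk]
    rcases hiddenWeight_eq_one_or_two γ f (H.adj_sub he : x ≠ y) with h | h <;> norm_num [h]

open Classical in
/-- A deterministic algorithm that is often correct on the hard instances makes many queries on
average. -/
theorem mul_card_correct_le {V : Type u} [Fintype V] {ι : Type*} [Fintype ι] (γ : V → Option ι)
    (T : Finset V) (d K : ℕ) (hd : ∀ g, (Finset.univ.filter fun v => γ v = some g).card ≤ d)
    (α μ B : ℝ) (hα : 0 ≤ α)
    (hB : ∀ f : ι → {v // γ v = none}, steinerCost T (hiddenWeight γ f) ≤ B)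
    (hK : α * B ≤ K) (hμ : μ ≤ 2 * ((T.card : ℝ) - 1) - α * B)
    (τ : QueryTree V (CompleteSubgraph V)) :
    Fintype.card {v // γ v = none} * μ * (Finset.univ.filter fun f : ι → {v // γ v = none} =>
        IsApproxSteinerTree T (hiddenWeight γ f) α (τ.output (hiddenWeight γ f))).card ≤
      2 * d * ∑ f : ι → {v // γ v = none}, ((τ.numQueries (hiddenWeight γ f) : ℝ) + K) := by
  -- Larger outputs are not probed, so that wrong outputs also add at most `K` queries; a correct
  -- one has at most `α * B ≤ K` edges.
  let L : CompleteSubgraph V → List (V × V) := fun H =>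
    if (edges H).card ≤ K then (edges H).toList.map Quot.out else []
  have hL : ∀ H, (L H).length ≤ K := by
    intro H
    simp only [L]
    split_ifs with h
    · simpa using h
    · simp
  have key := card_mul_sum_found_le γ (τ.thenProbe L)
  have hcorrect : ∀ f : ι → {v // γ v = none},
      IsApproxSteinerTree T (hiddenWeight γ f) α (τ.output (hiddenWeight γ f)) →
      μ ≤ d * (found γ f ((τ.thenProbe L).queries (hiddenWeight γ f))).card := by
    intro f hf
    have hcost : cost (hiddenWeight γ f) (τ.output (hiddenWeight γ f)) ≤ α * B :=
      hf.2.trans (mul_le_mul_of_nonneg_left (hB f) hα)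
    have hle : (edges (τ.output (hiddenWeight γ f))).card ≤ K := by
      exact_mod_cast (card_edges_le_cost γ f _).trans (hcost.trans hK)
    have h1 := hf.1.le_card_found γ d hd f
    have h2 : found γ f ((edges (τ.output (hiddenWeight γ f))).toList.map Quot.out) ⊆
        found γ f ((τ.thenProbe L).queries (hiddenWeight γ f)) := by
      intro g hg
      rw [found, Finset.mem_filter] at hg ⊢
      obtain ⟨-, p, hp, hpg⟩ := hg
      refine ⟨Finset.mem_univ _, p, ?_, hpg⟩
      rw [QueryTree.queries_thenProbe, List.mem_append]
      right
      simp only [L]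
      rwa [if_pos hle]
    have h3 : (d : ℝ) * (found γ f ((edges (τ.output (hiddenWeight γ f))).toList.map Quot.out)).card
        ≤ d * (found γ f ((τ.thenProbe L).queries (hiddenWeight γ f))).card := by
      gcongr
    linarith
  have hsum : μ * (Finset.univ.filter fun f : ι → {v // γ v = none} =>
        IsApproxSteinerTree T (hiddenWeight γ f) α (τ.output (hiddenWeight γ f))).card ≤
      d * ∑ f : ι → {v // γ v = none},
        ((found γ f ((τ.thenProbe L).queries (hiddenWeight γ f))).card : ℝ) := by
    rw [mul_comm μ, ← nsmul_eq_mul, Finset.mul_sum]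
    refine (Finset.card_nsmul_le_sum _ _ μ fun f hf =>
      hcorrect f (Finset.mem_filter.1 hf).2).trans ?_
    exact Finset.sum_le_sum_of_subset_of_nonneg (Finset.filter_subset _ _)
      fun f _ _ => by positivity
  have hnum : ∀ f : ι → {v // γ v = none},
      ((τ.thenProbe L).numQueries (hiddenWeight γ f) : ℝ) ≤ τ.numQueries (hiddenWeight γ f) + K := by
    intro f
    rw [← QueryTree.length_queries, QueryTree.queries_thenProbe, List.length_append,
      QueryTree.length_queries]
    exact_mod_cast Nat.add_le_add_left (hL _) _
  have key' : (Fintype.card {v // γ v = none} : ℝ) * ∑ f : ι → {v // γ v = none},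
        ((found γ f ((τ.thenProbe L).queries (hiddenWeight γ f))).card : ℝ) ≤
      2 * ∑ f : ι → {v // γ v = none}, ((τ.thenProbe L).numQueries (hiddenWeight γ f) : ℝ) := by
    exact_mod_cast key
  calc _ = (Fintype.card {v // γ v = none} : ℝ) * (μ * _) := mul_assoc _ _ _
    _ ≤ (Fintype.card {v // γ v = none} : ℝ) * (d * _) :=
        mul_le_mul_of_nonneg_left hsum (by positivity)
    _ = d * ((Fintype.card {v // γ v = none} : ℝ) * _) := by ring
    _ ≤ d * (2 * _) := mul_le_mul_of_nonneg_left key' (by positivity)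
    _ ≤ d * (2 * ∑ f : ι → {v // γ v = none}, ((τ.numQueries (hiddenWeight γ f) : ℝ) + K)) := by
        have := Finset.sum_le_sum fun (f : ι → {v // γ v = none}) (_ : f ∈ Finset.univ) => hnum f
        gcongr
    _ = _ := by ring

/-! ### From deterministic to randomized algorithms. -/

/-- If every deterministic algorithm that solves a fraction `p` of the inputs `w i` makes at least
`a p - K` queries on average, then a randomized algorithm that solves each of them with probability
`δ` makes an expected number of `a δ - K` queries on one of them. -/
theorem RandomizedAlgorithm.exists_le_expectedQueries {V O : Type u} {R : Type v}
    [MeasurableSpace R] (A : RandomizedAlgorithm V O R) {I : Type*} [Fintype I] [Nonempty I]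
    (w : I → V → V → ℝ) (good : I → Set O) (a δ : ℝ) (ha : 0 ≤ a) (K : ℕ)
    (hA : ∀ i, ENNReal.ofReal δ ≤ A.coins {r | (A.run r).output (w i) ∈ good i})
    (hdet : ∀ τ : QueryTree V O, a * ∑ i, (good i).indicator (fun _ => (1 : ℝ)) (τ.output (w i)) ≤
      ∑ i, ((τ.numQueries (w i) : ℝ) + K)) :
    ∃ i, ENNReal.ofReal (a * δ - K) ≤ A.expectedQueries (w i) := by
  have := A.isProbabilityMeasure
  have hpoint : ∀ r, ENNReal.ofReal a *
      ∑ i, {r | (A.run r).output (w i) ∈ good i}.indicator (fun _ => (1 : ENNReal)) r ≤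
      ∑ i, (((A.run r).numQueries (w i) : ENNReal) + K) := by
    intro r
    have h := ENNReal.ofReal_le_ofReal (hdet (A.run r))
    rw [ENNReal.ofReal_mul ha, ENNReal.ofReal_sum_of_nonneg
        (fun i _ => Set.indicator_nonneg (fun _ _ => zero_le_one) _),
      ENNReal.ofReal_sum_of_nonneg (fun i _ => by positivity)] at h
    convert h using 3 with i _ i _
    · by_cases hi : (A.run r).output (w i) ∈ good i <;> simp [Set.indicator, hi]
    · rw [ENNReal.ofReal_add (by positivity) (by positivity), ENNReal.ofReal_natCast,
        ENNReal.ofReal_natCast]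
  have hmeas : ∀ i, MeasurableSet {r | (A.run r).output (w i) ∈ good i} :=
    fun i => A.measurable_output (w i) (good i)
  have hmeas' : ∀ i, Measurable fun r => ((A.run r).numQueries (w i) : ENNReal) :=
    fun i => measurable_from_top.comp (A.measurable_numQueries (w i))
  have hint := lintegral_mono (μ := A.coins) hpoint
  rw [lintegral_const_mul _
      (Finset.measurable_sum _ fun i _ => measurable_const.indicator (hmeas i)),
    lintegral_finsetSum _ (fun i _ => measurable_const.indicator (hmeas i)),
    lintegral_finsetSum _ (fun i _ => (hmeas' i).add_const _)] at hint
  have hsum : ∑ _i : I, ENNReal.ofReal a * ENNReal.ofReal δ ≤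
      ∑ i, (A.expectedQueries (w i) + K) := by
    rw [← Finset.mul_sum]
    refine le_trans ?_ (hint.trans (le_of_eq ?_))
    · gcongr with i
      rw [lintegral_indicator (hmeas i)]
      simpa using hA i
    · refine Finset.sum_congr rfl fun i _ => ?_
      rw [lintegral_add_right _ measurable_const]
      simp [RandomizedAlgorithm.expectedQueries]
  obtain ⟨i, hi⟩ : ∃ i, ENNReal.ofReal a * ENNReal.ofReal δ ≤ A.expectedQueries (w i) + K := by
    by_contra! hlt
    exact (ENNReal.sum_lt_sum_of_nonempty Finset.univ_nonempty fun i _ => hlt i).not_ge hsum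
  refine ⟨i, ?_⟩
  rw [ENNReal.ofReal_sub _ (by positivity), ENNReal.ofReal_mul ha, ENNReal.ofReal_natCast]
  exact tsub_le_iff_right.2 hi

/-! ### Grouping the terminals and choosing the parameters. -/

open Classical in
/-- `m * d` elements of `T` can be partitioned into `m` groups of size at most `d`. -/
theorem exists_grouping {V : Type u} [Fintype V] (T : Finset V) (m d : ℕ) (h : m * d ≤ T.card) :
    ∃ γ : V → Option (Fin m),
      (∀ g, (Finset.univ.filter fun v => γ v = some g).card ≤ d) ∧
      (T.filter fun v => γ v = none).card + m * d = T.card ∧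
      Fintype.card {v // γ v = none} + m * d = Fintype.card V := by
  obtain ⟨U, hU, hcard⟩ := Finset.exists_subset_card_eq h
  have e : U ≃ Fin m × Fin d := Fintype.equivOfCardEq (by simp [hcard])
  let γ : V → Option (Fin m) := fun v => if hv : v ∈ U then some (e ⟨v, hv⟩).1 else none
  have hnone : ∀ v, γ v = none ↔ v ∉ U := by
    intro v
    by_cases hv : v ∈ U <;> simp [γ, hv]
  refine ⟨γ, fun g => ?_, ?_, ?_⟩
  · have hsub : (Finset.univ.filter fun v => γ v = some g) ⊆
        (Finset.univ : Finset (Fin d)).image fun j => ((e.symm (g, j) : U) : V) := by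
      intro v hv
      have hv := (Finset.mem_filter.1 hv).2
      have hvU : v ∈ U := by
        by_contra hc
        rw [(hnone v).2 hc] at hv
        cases hv
      simp only [γ, dif_pos hvU, Option.some.injEq] at hv
      rw [Finset.mem_image]
      refine ⟨(e ⟨v, hvU⟩).2, Finset.mem_univ _, ?_⟩
      rw [← hv]
      simp
    simpa using (Finset.card_le_card hsub).trans Finset.card_image_le
  · have : (T.filter fun v => γ v = none) = T \ U := by
      ext v
      simp [hnone]
    rw [this, ← hcard]
    exact Finset.card_sdiff_add_card_eq_card hU
  · have : (Finset.univ.filter fun v => γ v = none) = Finset.univ \ U := by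
      ext v
      simp [hnone]
    rw [Fintype.card_subtype, this, ← hcard]
    exact Finset.card_sdiff_add_card_eq_card (Finset.subset_univ U)

/-- The lower bound in terms of the parameters of the grouping. -/
theorem exists_le_expectedQueries_of_grouping {V : Type u} [Fintype V] (T : Finset V) (m d : ℕ)
    (hm : 0 < m) (hd : 0 < d) (h : m * d ≤ T.card) (hlt : m * d < Fintype.card V)
    (α μ B δ : ℝ) (K : ℕ) (hα : 0 ≤ α) (hμ₀ : 0 ≤ μ)
    (hB : (T.card : ℝ) + 2 * (m + (T.card - m * d)) ≤ B) (hK : α * B ≤ K)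
    (hμ : μ ≤ 2 * ((T.card : ℝ) - 1) - α * B) {R : Type v} [MeasurableSpace R]
    (A : RandomizedAlgorithm V (CompleteSubgraph V) R) (hA : A.ComputesApproxSteinerTree T α δ) :
    ∃ w : V → V → ℝ, IsMetric w ∧ (∀ x y, x ≠ y → w x y = 1 ∨ w x y = 2) ∧
      ENNReal.ofReal ((Fintype.card V - m * d) * μ / (2 * d) * δ - K) ≤ A.expectedQueries w := by
  classical
  obtain ⟨γ, hγd, hγT, hγV⟩ := exists_grouping T m d h
  have hcT : ((T.filter fun v => γ v = none).card : ℝ) = T.card - m * d := by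
    rw [← hγT]; push_cast; ring
  have hcV : (Fintype.card {v // γ v = none} : ℝ) = Fintype.card V - m * d := by
    rw [← hγV]; push_cast; ring
  have : Nonempty (Fin m) := ⟨⟨0, hm⟩⟩
  have : Nonempty {v // γ v = none} := by
    rw [← Fintype.card_pos_iff]
    omega
  have hB' : ∀ f : Fin m → {v // γ v = none}, steinerCost T (hiddenWeight γ f) ≤ B := by
    intro f
    refine (steinerCost_hiddenWeight_le γ T f).trans ?_
    rw [hcT, Fintype.card_fin]
    exact hB
  have hd' : (0 : ℝ) < d := by exact_mod_cast hd
  obtain ⟨f, hf⟩ := A.exists_le_expectedQueries (fun f : Fin m → {v // γ v = none} =>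
      hiddenWeight γ f) (fun f => {H | IsApproxSteinerTree T (hiddenWeight γ f) α H})
    ((Fintype.card V - m * d) * μ / (2 * d)) δ (by rw [← hcV]; positivity) K
    (fun f => hA _ (isMetric_hiddenWeight γ f)) (fun τ => by
      have := mul_card_correct_le γ T d K (fun g => by convert hγd g) α μ B hα hB' hK hμ τ
      rw [hcV, Finset.card_filter] at this
      push_cast at this
      rw [div_mul_eq_mul_div, div_le_iff₀ (by positivity), mul_comm _ (2 * (d : ℝ))]
      simp only [Set.indicator_apply, Set.mem_ofPred_eq]
      refine (le_of_eq ?_).trans (this.trans (le_of_eq ?_)) <;> congr!)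
  exact ⟨_, isMetric_hiddenWeight γ f, fun x y => hiddenWeight_eq_one_or_two γ f, hf⟩

end SteinerQuery

theorem theorem1p2 (ε : ℝ) (hε₀ : 0 < ε) (hε₁ : ε < 1 / 3) (δ : ℝ) (hδ₀ : 0 < δ) (hδ₁ : δ ≤ 1) :
    ∃ c : ℝ, 0 < c ∧ ∃ k₀ : ℕ,
      ∀ (n k : ℕ), k₀ ≤ k → k ≤ n →
      ∀ (V : Type u) [Fintype V] (T : Finset V), Fintype.card V = n → T.card = k →
      ∀ (R : Type v) [MeasurableSpace R]
        (A : SteinerQuery.RandomizedAlgorithm V (SteinerQuery.CompleteSubgraph V) R),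
        A.ComputesApproxSteinerTree T (2 - ε) δ →
        ∃ w : V → V → ℝ, SteinerQuery.IsMetric w ∧
          (∀ x y, x ≠ y → w x y = 1 ∨ w x y = 2) ∧
          ENNReal.ofReal (c * (n * k)) ≤ A.expectedQueries w := by
  -- This makes the loss `12 k / d` in the tree cost at most `εk/3`.
  obtain ⟨d, hd⟩ := exists_nat_ge (36 / ε)
  have hd36 : 36 ≤ ε * d := by rwa [div_le_iff₀' hε₀] at hd
  have hd6 : (6 : ℝ) ≤ d := by nlinarith
  have hdpos : (0 : ℝ) < d := by linarith
  have hdN : 0 < d := by exact_mod_cast hdpos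
  refine ⟨ε * δ / (8 * d ^ 2), by positivity, ?_⟩
  -- The terms control, in order, the rounding in `q`, the additive `2` in `2 (k - 1)`, and the `4k`
  -- probing queries.
  obtain ⟨k₀, hk₀⟩ := exists_nat_ge ((d : ℝ) ^ 3 + 12 / ε + 32 * d ^ 2 / (ε * δ))
  refine ⟨k₀, fun n k hk hkn V _ T hV hT R _ A hA => ?_⟩
  have hkR : (k₀ : ℝ) ≤ k := by exact_mod_cast hk
  have hknR : (k : ℝ) ≤ n := by exact_mod_cast hkn
  have p1 : 0 < 12 / ε := by positivity
  have p2 : 0 < 32 * (d : ℝ) ^ 2 / (ε * δ) := by positivity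
  have p3 : 0 < (d : ℝ) ^ 3 := by positivity
  have hk3 : (d : ℝ) ^ 3 ≤ k := by linarith
  have hkε : 12 ≤ ε * k := (div_le_iff₀' hε₀).1 (by linarith)
  have hnδ : 32 * (d : ℝ) ^ 2 ≤ ε * δ * n := (div_le_iff₀' (by positivity)).1 (by linarith)
  have hkpos : (0 : ℝ) < k := by linarith
  -- There will be `(d - 1) * q` groups of size `d`.
  set q := k / d ^ 2 with hq
  have hq1 : d ^ 2 * q ≤ k := Nat.mul_div_le k (d ^ 2)
  have hq2 : k < d ^ 2 * q + d ^ 2 := Nat.lt_mul_div_succ k (by positivity)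
  have hq1R : (d : ℝ) ^ 2 * q ≤ k := by exact_mod_cast hq1
  have hq2R : (k : ℝ) ≤ d ^ 2 * q + d ^ 2 := by exact_mod_cast hq2.le
  have hqpos : 0 < q := by
    refine Nat.div_pos ?_ (by positivity)
    have : (d : ℝ) ^ 2 ≤ k := (pow_le_pow_right₀ (by linarith) (by norm_num)).trans hk3
    exact_mod_cast this
  obtain ⟨b, rfl⟩ : ∃ b, d = b + 1 := ⟨d - 1, by omega⟩
  set D : ℝ := ((b + 1 : ℕ) : ℝ) with hD
  have hb : (b : ℝ) = D - 1 := by rw [hD]; push_cast; ring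
  have hbpos : 0 < b := by
    have : (0 : ℝ) < b := by linarith
    exact_mod_cast this
  have hmd : (((b * q : ℕ) : ℝ)) * D = (D - 1) * D * q := by push_cast; rw [hb]; ring
  have hinv : (k : ℝ) / D * D = k := div_mul_cancel₀ _ hdpos.ne'
  set y : ℝ := k / D with hy
  have hqy : D * q ≤ y := by rw [hy, le_div_iff₀ hdpos]; linarith
  have hqy2 : y ≤ D * q + D := by rw [hy, div_le_iff₀ hdpos]; linarith
  have hDy : D ^ 2 ≤ y := by rw [hy, le_div_iff₀ hdpos]; linarith
  have hD1 : 0 ≤ D - 1 := by linarith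
  have hmd_le : (D - 1) * D * q ≤ k - y := by
    have := mul_le_mul_of_nonneg_left hqy hD1
    linarith
  have hmd_ge : (k : ℝ) - 2 * y ≤ (D - 1) * D * q := by
    have := mul_le_mul_of_nonneg_left hqy2 hD1
    linarith
  have hm_le : ((b * q : ℕ) : ℝ) ≤ y := by push_cast; rw [hb]; linarith [Nat.cast_nonneg (α := ℝ) q]
  have hypos : 0 < y := by positivity
  have hltR : ((b * q * (b + 1) : ℕ) : ℝ) < k := by
    rw [Nat.cast_mul, hmd]; linarith
  have hlt : b * q * (b + 1) < k := by exact_mod_cast hltR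
  have hyε : 36 * y ≤ ε * k := by
    calc 36 * y ≤ ε * D * y := mul_le_mul_of_nonneg_right hd36 hypos.le
      _ = ε * (y * D) := by ring
      _ = ε * k := by rw [hinv]
  have hy6 : 6 * y ≤ k := by
    have := mul_le_mul_of_nonneg_right hd6 hypos.le
    linarith
  have hεy : 0 < ε * y := by positivity
  have hB : (2 - ε) * (k + 6 * y) = 2 * k + 12 * y - ε * k - 6 * (ε * y) := by ring
  -- There are at most `y = k / D` groups and at most `2y` ungrouped terminals, whence `B = k + 6y`.
  -- Then `μ = εk/2` is what is left of `εk` after losing `12y ≤ εk/3` and `2 ≤ εk/6`, and `6y ≤ k`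
  -- gives `K = 4k`.
  obtain ⟨w, hw1, hw2, hw3⟩ := SteinerQuery.exists_le_expectedQueries_of_grouping T (b * q) (b + 1)
    (Nat.mul_pos hbpos hqpos) hdN (by omega) (by omega) (2 - ε) (ε * k / 2) (k + 6 * y) δ (4 * k)
    (by linarith) (by positivity) (by rw [hT, hmd]; linarith) (by push_cast; linarith)
    (by rw [hT]; linarith) A hA
  refine ⟨w, hw1, hw2, le_trans (ENNReal.ofReal_le_ofReal ?_) hw3⟩
  rw [hV, hmd]
  -- The number of candidate centres is at least `n - k + y`, and `(n - k) / D ≤ n - k`.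
  have hN : (n : ℝ) / D ≤ n - (D - 1) * D * q := by
    have : (n : ℝ) / D - y ≤ n - k := by
      rw [hy, ← sub_div]
      exact div_le_self (by linarith) (by linarith)
    linarith
  have hmain : (n : ℝ) / D * (ε * k / 2) / (2 * D) * δ ≤
      (n - (D - 1) * D * q) * (ε * k / 2) / (2 * D) * δ := by
    gcongr
  -- The constant `c` is half of what the bound gives; the other half absorbs `K = 4k`.
  have heq : (n : ℝ) / D * (ε * k / 2) / (2 * D) * δ = 2 * (ε * δ / (8 * D ^ 2) * (n * k)) := by
    field_simp
    norm_num
  have hsmall : 4 * (k : ℝ) ≤ ε * δ / (8 * D ^ 2) * (n * k) := by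
    rw [div_mul_eq_mul_div, le_div_iff₀ (by positivity)]
    have := mul_le_mul_of_nonneg_right hnδ hkpos.le
    linarith
  rw [Nat.cast_mul, Nat.cast_ofNat, ← hD]
  linarith
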